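/- Theorem 4.2 (spherical Euler inequality in $n$ dimensions). Let $n\ge 1$ and let $S$ be an $n$-dimensional spherical simplex on the unit sphere $\mathbb{S}^n\subset\mathbb{R}^{n+1}$, i.e. the set of points of $\mathbb{S}^n$ that are nonnegative linear combinations of $n+1$ linearly independent unit vectors (its vertices); the facet opposite to a vertex is the set of points of $\mathbb{S}^n$ that are nonnegative linear combinations of the other vertices. Distances are great-circle distances. Then there is exactly one number $R<\pi/2$ (the circumradius) such that some point of $\mathbb{S}^n$ is at distance $R$ from all the vertices, and exactly one number $r>0$ (the inradius) such that some closed spherical ball of radius $r$ is contained in $S$ and its boundary sphere meets every facet, and these satisfy $$\tan R\ \ge\ n\tan r .$$ -/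

import Mathlib

/-- A (nondegenerate) spherical `n`-simplex on the unit sphere of `ℝⁿ⁺¹`, given by its `n + 1`
vertices: linearly independent unit vectors. -/
structure SphericalSimplex (n : ℕ) where
  vertex : Fin (n + 1) → EuclideanSpace ℝ (Fin (n + 1))
  norm_vertex : ∀ i, ‖vertex i‖ = 1
  linearIndependent_vertex : LinearIndependent ℝ vertex

namespace SphericalSimplex

/-- The great-circle distance between two points of the unit sphere: the angle between them. -/
noncomputable def sphericalDist {n : ℕ} (x y : EuclideanSpace ℝ (Fin (n + 1))) : ℝ :=
  InnerProductGeometry.angle x y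

/-- The closed spherical ball (cap) on the unit sphere with centre `c` and radius `r`. -/
def sphericalClosedBall {n : ℕ} (c : EuclideanSpace ℝ (Fin (n + 1))) (r : ℝ) :
    Set (EuclideanSpace ℝ (Fin (n + 1))) :=
  {x | ‖x‖ = 1 ∧ sphericalDist c x ≤ r}

/-- The solid spherical simplex: the spherical convex hull of the vertices, that is, the points of
the unit sphere that are nonnegative combinations of the vertices. -/
def region {n : ℕ} (S : SphericalSimplex n) : Set (EuclideanSpace ℝ (Fin (n + 1))) :=
  {x | ‖x‖ = 1 ∧ ∃ a : Fin (n + 1) → ℝ, (∀ j, 0 ≤ a j) ∧ x = ∑ j, a j • S.vertex j}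

/-- The facet opposite to vertex `i`: the spherical convex hull of the other vertices. -/
def facet {n : ℕ} (S : SphericalSimplex n) (i : Fin (n + 1)) :
    Set (EuclideanSpace ℝ (Fin (n + 1))) :=
  {x | ‖x‖ = 1 ∧ ∃ a : Fin (n + 1) → ℝ, (∀ j, 0 ≤ a j) ∧ a i = 0 ∧ x = ∑ j, a j • S.vertex j}

/-- `R` is the circumradius: some point of the sphere is at spherical distance `R` from all the
vertices. Of the two antipodal centres of the circumscribed sphere, the one with radius less than
`π / 2` is meant. -/
def IsCircumradius {n : ℕ} (S : SphericalSimplex n) (R : ℝ) : Prop :=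
  R < Real.pi / 2 ∧
    ∃ c : EuclideanSpace ℝ (Fin (n + 1)), ‖c‖ = 1 ∧ ∀ i, sphericalDist c (S.vertex i) = R

/-- `r` is the inradius: some spherical ball of radius `r > 0` is inscribed in the simplex, that is,
it lies in the simplex and its boundary sphere touches every facet. -/
def IsInradius {n : ℕ} (S : SphericalSimplex n) (r : ℝ) : Prop :=
  0 < r ∧
    ∃ c : EuclideanSpace ℝ (Fin (n + 1)), ‖c‖ = 1 ∧ sphericalClosedBall c r ⊆ S.region ∧
      ∀ i, ∃ x ∈ S.facet i, sphericalDist c x = r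

end SphericalSimplex

/-!
The simplex spans a simplicial cone in `ℝⁿ⁺¹`, and everything is expressed through the basis of
vertices `vᵢ` and its dual basis `uᵢ`: the simplex is cut out of the sphere by the inequalities
`⟪uᵢ, x⟫ ≥ 0`, and the facet opposite to `vᵢ` by the further equation `⟪uᵢ, x⟫ = 0`.

A centre `c` of the circumscribed sphere with `R < π / 2` has the same positive inner product `cos R`
with all vertices, so `c = cos R • w` with `w = ∑ uᵢ`, and `cos R = 1 / ‖w‖`. An inscribed cap of
radius `r` has its centre at distance `r` from every facet hyperplane, that is,
`⟪uᵢ, c⟫ = sin r * ‖uᵢ‖`, so `c = sin r • p` with `p = ∑ ‖uᵢ‖ • vᵢ`, and `sin r = 1 / ‖p‖`.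
Conversely these formulas do define a circumscribed sphere and an inscribed cap
(`isCircumradius_iff`, `isInradius_iff`). This gives existence and uniqueness, and
`tan² R = ‖w‖² - 1`, `tan² r = 1 / (‖p‖² - 1)`.

It remains to see that `n² ≤ (‖w‖² - 1) (‖p‖² - 1)` (`sq_le_norm_sq_sub_one_mul`). Let `c = w / ‖w‖`
be the circumcentre, `dᵢ = ‖uᵢ‖`, `aᵢ = ⟪uᵢ, c⟫` and `eᵢ = √(dᵢ² - aᵢ²)`. As in the Euclidean proof,
which sums `altitude ≤ R + distance of the circumcentre from the facet` with the facet volumes as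
weights, splitting `1 = ⟪uᵢ, vᵢ⟫` into the parts along and orthogonal to `c` gives
`1 ≤ aᵢ cos R + eᵢ sin R`. Since `∑ aᵢ = ⟪w, c⟫ = 1 / cos R`, summation yields `n ≤ sin R * ∑ eᵢ`.
By Cauchy–Schwarz, `(∑ eᵢ)² ≤ ∑ (dᵢ - aᵢ) * ∑ (dᵢ + aᵢ) = (∑ dᵢ)² - ‖w‖²`, and finally
`cos R * ∑ dᵢ = ⟪p, c⟫ ≤ ‖p‖`.
-/

open InnerProductGeometry
open scoped RealInnerProductSpace

/-! ### Caps and half-spaces -/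

section Cap

variable {E : Type*} [NormedAddCommGroup E] [InnerProductSpace ℝ E]

/-- If the cap of centre `c` and radius `r ≤ π / 2` lies in the half-space `⟪u, ·⟫ ≥ 0`, then `c` is
at spherical distance at least `r` from the boundary of that half-space. -/
theorem norm_mul_sin_le_inner_of_cap {u c : E} {r : ℝ} (hc : ‖c‖ = 1) (h0 : 0 ≤ r)
    (hr : r ≤ Real.pi / 2) (h : ∀ x : E, ‖x‖ = 1 → angle c x ≤ r → 0 ≤ ⟪u, x⟫) :
    ‖u‖ * Real.sin r ≤ ⟪u, c⟫ := by
  have hpi := Real.pi_pos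
  have hs0 : 0 ≤ ⟪u, c⟫ := by
    refine h c hc ?_
    rw [angle_self (norm_ne_zero_iff.mp (by rw [hc]; exact one_ne_zero))]
    exact h0
  have hcc : ⟪c, c⟫ = 1 := by rw [real_inner_self_eq_norm_sq, hc, one_pow]
  have hcos : 0 ≤ Real.cos r := Real.cos_nonneg_of_mem_Icc ⟨by linarith, hr⟩
  have hsin : 0 ≤ Real.sin r := Real.sin_nonneg_of_nonneg_of_le_pi h0 (by linarith)
  obtain ⟨m, hm⟩ : ∃ m, m = u - ⟪u, c⟫ • c := ⟨_, rfl⟩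
  have hmc : ⟪c, m⟫ = 0 := by
    rw [hm, inner_sub_right, inner_smul_right, hcc, real_inner_comm]; ring
  have hum : ⟪u, m⟫ = ‖m‖ ^ 2 := by
    have : u = m + ⟪u, c⟫ • c := by rw [hm]; abel
    nth_rw 1 [this]
    rw [inner_add_left, real_inner_smul_left, hmc, real_inner_self_eq_norm_sq]; ring
  have hnorm : ‖m‖ ^ 2 = ‖u‖ ^ 2 - ⟪u, c⟫ ^ 2 := by
    rw [← hum, hm, inner_sub_right, inner_smul_right, real_inner_self_eq_norm_sq]; ring
  refine le_of_sq_le_sq ?_ hs0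
  have hsc := Real.sin_sq_add_cos_sq r
  rcases eq_or_ne m 0 with h' | h'
  · rw [h', norm_zero] at hnorm
    nlinarith [sq_nonneg (Real.cos r), sq_nonneg ‖u‖, mul_nonneg (sq_nonneg (Real.cos r))
      (sq_nonneg ‖u‖)]
  have hmpos : 0 < ‖m‖ := norm_pos_iff.mpr h'
  -- The point of the cap's boundary sphere reached from `c` by moving in the direction `-m`; it
  -- minimizes `⟪u, ·⟫` on that sphere.
  obtain ⟨x, hx⟩ : ∃ x, x = Real.cos r • c - (Real.sin r / ‖m‖) • m := ⟨_, rfl⟩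
  have hcx : ⟪c, x⟫ = Real.cos r := by
    rw [hx, inner_sub_right, inner_smul_right, inner_smul_right, hcc, hmc]; ring
  have hxn : ‖x‖ = 1 := by
    have : ‖x‖ ^ 2 = 1 := by
      rw [hx, norm_sub_sq_real, norm_smul, norm_smul, real_inner_smul_left, inner_smul_right, hmc,
        hc, Real.norm_eq_abs, Real.norm_eq_abs, mul_pow, mul_pow, sq_abs, sq_abs, mul_zero,
        mul_zero]
      field_simp
      linarith
    exact (pow_eq_one_iff_of_nonneg (norm_nonneg x) two_ne_zero).mp this
  have hux := h x hxn (by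
    rw [angle, hcx, hc, hxn, mul_one, div_one, Real.arccos_cos h0 (by linarith)])
  have hux' : Real.sin r * ‖m‖ ≤ ⟪u, c⟫ * Real.cos r := by
    rw [hx, inner_sub_right, inner_smul_right, inner_smul_right, hum] at hux
    have : Real.sin r / ‖m‖ * ‖m‖ ^ 2 = Real.sin r * ‖m‖ := by field_simp
    linarith
  have := pow_le_pow_left₀ (by positivity) hux' 2
  rw [mul_pow, mul_pow, hnorm] at this
  rw [mul_pow]
  linear_combination this + ⟪u, c⟫ ^ 2 * hsc

/-- If the cap of centre `c` and radius `r` reaches the hyperplane `⟪u, ·⟫ = 0`, then `c` is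
at spherical distance at most `r` from that hyperplane. -/
theorem inner_le_norm_mul_sin_of_touches {u c x : E} {r : ℝ} (hc : ‖c‖ = 1)
    (hr : r ≤ Real.pi / 2) (hux : ⟪u, x⟫ = 0) (hx : angle c x = r) :
    ⟪u, c⟫ ≤ ‖u‖ * Real.sin r := by
  have h1 := angle_le_angle_add_angle u c x
  rw [(inner_eq_zero_iff_angle_eq_pi_div_two u x).mp hux, hx] at h1
  have h2 : Real.cos (angle u c) ≤ Real.cos (Real.pi / 2 - r) :=
    Real.cos_le_cos_of_nonneg_of_le_pi (by linarith) (angle_le_pi u c) (by linarith)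
  rw [Real.cos_pi_div_two_sub] at h2
  rw [← cos_angle_mul_norm_mul_norm u c, hc, mul_one, mul_comm]
  exact mul_le_mul_of_nonneg_left h2 (norm_nonneg u)

/-- A cap whose centre is at distance at least its radius from the boundary of a half-space lies in
that half-space. -/
theorem inner_nonneg_of_cap {u c x : E} {r : ℝ} (hc : ‖c‖ = 1) (h0 : 0 ≤ r)
    (hr : r ≤ Real.pi / 2) (hu : ‖u‖ * Real.sin r ≤ ⟪u, c⟫) (hx : angle c x ≤ r) :
    0 ≤ ⟪u, x⟫ := by
  rcases eq_or_ne u 0 with rfl | hu0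
  · simp
  have h1 : Real.sin r ≤ Real.cos (angle u c) := by
    rw [cos_angle, hc, mul_one, le_div_iff₀ (norm_pos_iff.mpr hu0), mul_comm]
    exact hu
  have h2 : angle u c ≤ Real.pi / 2 - r := by
    rw [← Real.cos_pi_div_two_sub] at h1
    exact (Real.strictAntiOn_cos.le_iff_ge ⟨by linarith, by linarith [Real.pi_pos]⟩
      ⟨angle_nonneg u c, angle_le_pi u c⟩).mp h1
  have h3 := angle_le_angle_add_angle u c x
  rw [← cos_angle_mul_norm_mul_norm u x]
  exact mul_nonneg (Real.cos_nonneg_of_mem_Icc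
    ⟨by linarith [angle_nonneg u x, Real.pi_pos], by linarith⟩) (by positivity)

/-- In the decomposition of `u` and the unit vector `v` into parts along and orthogonal to a unit
vector `c`, the Cauchy–Schwarz inequality for the orthogonal parts. -/
theorem inner_sub_mul_inner_le {u v c : E} (hc : ‖c‖ = 1) (hv : ‖v‖ = 1) :
    ⟪u, v⟫ - ⟪u, c⟫ * ⟪v, c⟫ ≤ √(‖u‖ ^ 2 - ⟪u, c⟫ ^ 2) * √(1 - ⟪v, c⟫ ^ 2) := by
  have hcc : ⟪c, c⟫ = 1 := by rw [real_inner_self_eq_norm_sq, hc, one_pow]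
  have key : ∀ y z : E, ⟪y - ⟪y, c⟫ • c, z - ⟪z, c⟫ • c⟫ = ⟪y, z⟫ - ⟪y, c⟫ * ⟪z, c⟫ := by
    intro y z
    simp only [inner_sub_left, inner_sub_right, real_inner_smul_left, inner_smul_right, hcc,
      real_inner_comm z c]
    ring
  have hn : ∀ y : E, ‖y - ⟪y, c⟫ • c‖ = √(‖y‖ ^ 2 - ⟪y, c⟫ ^ 2) := by
    intro y
    rw [norm_eq_sqrt_real_inner, key, real_inner_self_eq_norm_sq, sq ⟪y, c⟫]
  have := real_inner_le_norm (u - ⟪u, c⟫ • c) (v - ⟪v, c⟫ • c)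
  rwa [key, hn, hn, hv, one_pow] at this

end Cap

namespace SphericalSimplex

variable {n : ℕ} (S : SphericalSimplex n)

/-! ### The dual basis and the two centres -/

/-- The vertices as a basis of the ambient space. -/
noncomputable def basis : Module.Basis (Fin (n + 1)) ℝ (EuclideanSpace ℝ (Fin (n + 1))) :=
  basisOfLinearIndependentOfCardEqFinrank S.linearIndependent_vertex (by simp)

/-- The dual basis of the vertices: `S.dual i` is an inward normal of the facet opposite to
vertex `i`, scaled to have inner product `1` with that vertex. -/
noncomputable def dual (i : Fin (n + 1)) : EuclideanSpace ℝ (Fin (n + 1)) :=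
  (InnerProductSpace.toDual ℝ _).symm (LinearMap.toContinuousLinearMap (S.basis.coord i))

/-- The vector having inner product `1` with every vertex; it points to the circumcentre. -/
noncomputable def circumVector : EuclideanSpace ℝ (Fin (n + 1)) :=
  ∑ i, S.dual i

/-- The vector at distance `1` from every facet hyperplane, on the inner side; it points to the
incentre. -/
noncomputable def inVector : EuclideanSpace ℝ (Fin (n + 1)) :=
  ∑ i, ‖S.dual i‖ • S.vertex i

@[simp] theorem basis_apply (i : Fin (n + 1)) : S.basis i = S.vertex i := by
  simp [basis]

theorem inner_dual (i : Fin (n + 1)) (x : EuclideanSpace ℝ (Fin (n + 1))) :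
    ⟪S.dual i, x⟫ = S.basis.repr x i := by
  rw [dual, InnerProductSpace.toDual_symm_apply]
  rfl

theorem inner_dual_sum (i : Fin (n + 1)) (a : Fin (n + 1) → ℝ) :
    ⟪S.dual i, ∑ j, a j • S.vertex j⟫ = a i := by
  rw [inner_dual]
  simp only [← basis_apply, Module.Basis.repr_sum_self]

theorem inner_dual_vertex (i j : Fin (n + 1)) :
    ⟪S.dual i, S.vertex j⟫ = if j = i then 1 else 0 := by
  rw [inner_dual, ← basis_apply, Module.Basis.repr_self, Finsupp.single_apply]

theorem sum_inner_dual_smul (x : EuclideanSpace ℝ (Fin (n + 1))) :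
    ∑ i, ⟪S.dual i, x⟫ • S.vertex i = x := by
  simp only [inner_dual, ← basis_apply, Module.Basis.sum_repr]

theorem ext_inner_vertex {x y : EuclideanSpace ℝ (Fin (n + 1))}
    (h : ∀ i, ⟪x, S.vertex i⟫ = ⟪y, S.vertex i⟫) : x = y := by
  refine InnerProductSpace.ext_inner_right_basis S.basis fun i => ?_
  rw [basis_apply]
  exact h i

theorem mem_region_iff {x : EuclideanSpace ℝ (Fin (n + 1))} :
    x ∈ S.region ↔ ‖x‖ = 1 ∧ ∀ i, 0 ≤ ⟪S.dual i, x⟫ := by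
  constructor
  · rintro ⟨hx, a, ha, rfl⟩
    exact ⟨hx, fun i => (S.inner_dual_sum i a).symm ▸ ha i⟩
  · rintro ⟨hx, h⟩
    exact ⟨hx, _, h, (S.sum_inner_dual_smul x).symm⟩

theorem mem_facet_iff {i : Fin (n + 1)} {x : EuclideanSpace ℝ (Fin (n + 1))} :
    x ∈ S.facet i ↔ x ∈ S.region ∧ ⟪S.dual i, x⟫ = 0 := by
  constructor
  · rintro ⟨hx, a, ha, hi, rfl⟩
    exact ⟨⟨hx, a, ha, rfl⟩, (S.inner_dual_sum i a).trans hi⟩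
  · rintro ⟨h, hi⟩
    rw [mem_region_iff] at h
    exact ⟨h.1, _, h.2, hi, (S.sum_inner_dual_smul x).symm⟩

theorem inner_circumVector_vertex (i : Fin (n + 1)) : ⟪S.circumVector, S.vertex i⟫ = 1 := by
  simp [circumVector, sum_inner, inner_dual_vertex]

theorem inner_dual_inVector (i : Fin (n + 1)) : ⟪S.dual i, S.inVector⟫ = ‖S.dual i‖ :=
  S.inner_dual_sum i _

theorem one_le_norm_circumVector : 1 ≤ ‖S.circumVector‖ := by
  have := real_inner_le_norm S.circumVector (S.vertex 0)
  rwa [inner_circumVector_vertex, S.norm_vertex, mul_one] at this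

/-- No unit vector `c` is the inward unit normal of every facet at once. -/
theorem exists_inner_dual_lt_norm (hn : 1 ≤ n) {c : EuclideanSpace ℝ (Fin (n + 1))}
    (hc : ‖c‖ = 1) : ∃ i, ⟪S.dual i, c⟫ < ‖S.dual i‖ := by
  by_contra! h
  have hpar : ∀ i, S.dual i = ‖S.dual i‖ • c := by
    intro i
    have h1 : ⟪S.dual i, c⟫ = ‖S.dual i‖ * ‖c‖ :=
      le_antisymm (real_inner_le_norm _ _) (by rw [hc, mul_one]; exact h i)
    rw [inner_eq_norm_mul_iff_real, hc, one_smul] at h1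
    exact h1
  have hne : (⟨1, by omega⟩ : Fin (n + 1)) ≠ 0 := by simp [Fin.ext_iff]
  -- All dual vectors are positive multiples of `c`, yet they do not vanish on the same vertices.
  have h0 := S.inner_dual_vertex 0 0
  have h1 := S.inner_dual_vertex ⟨1, by omega⟩ 0
  have h2 := S.inner_dual_vertex ⟨1, by omega⟩ ⟨1, by omega⟩
  rw [hpar, real_inner_smul_left, if_pos rfl] at h0 h2
  rw [hpar, real_inner_smul_left, if_neg hne.symm] at h1
  rcases mul_eq_zero.mp h1 with h' | h'
  · rw [h', zero_mul] at h2
    exact zero_ne_one h2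
  · rw [h', mul_zero] at h0
    exact zero_ne_one h0

theorem inVector_ne_zero : S.inVector ≠ 0 := by
  intro h
  have h1 := S.inner_dual_inVector 0
  rw [h, inner_zero_right, eq_comm, norm_eq_zero] at h1
  have h2 := S.inner_dual_vertex 0 0
  simp [h1] at h2

theorem one_lt_norm_inVector (hn : 1 ≤ n) : 1 < ‖S.inVector‖ := by
  have hpos : 0 < ‖S.inVector‖ := norm_pos_iff.mpr S.inVector_ne_zero
  obtain ⟨i, hi⟩ := S.exists_inner_dual_lt_norm hn
    (c := ‖S.inVector‖⁻¹ • S.inVector) (norm_smul_inv_norm S.inVector_ne_zero)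
  rw [inner_smul_right, inner_dual_inVector, inv_mul_lt_iff₀ hpos] at hi
  by_contra! h
  nlinarith [norm_nonneg (S.dual i)]

/-! ### The circumradius and the inradius -/

theorem isCircumradius_iff {R : ℝ} :
    S.IsCircumradius R ↔ R = Real.arccos ‖S.circumVector‖⁻¹ := by
  have hpos : 0 < ‖S.circumVector‖ := one_pos.trans_le S.one_le_norm_circumVector
  constructor
  · rintro ⟨hR, c, hc, h⟩
    have h0 : 0 ≤ R := h 0 ▸ angle_nonneg _ _
    have hcos : 0 < Real.cos R := Real.cos_pos_of_mem_Ioo ⟨by linarith [Real.pi_pos], hR⟩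
    have hcw : c = Real.cos R • S.circumVector := by
      refine S.ext_inner_vertex fun i => ?_
      rw [real_inner_smul_left, inner_circumVector_vertex, ← h i, sphericalDist, cos_angle, hc,
        S.norm_vertex, mul_one, mul_one, div_one]
    have hn : Real.cos R * ‖S.circumVector‖ = 1 := by
      rw [← hc, hcw, norm_smul, Real.norm_eq_abs, abs_of_pos hcos]
    rw [← eq_inv_of_mul_eq_one_left hn, Real.arccos_cos h0 (by linarith [Real.pi_pos])]
  · rintro rfl
    refine ⟨Real.arccos_lt_pi_div_two.mpr (inv_pos.mpr hpos),
      ‖S.circumVector‖⁻¹ • S.circumVector, norm_smul_inv_norm (norm_pos_iff.mp hpos), fun i => ?_⟩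
    rw [sphericalDist, angle_smul_left_of_pos _ _ (inv_pos.mpr hpos), angle,
      inner_circumVector_vertex, S.norm_vertex, mul_one, one_div]

theorem isInradius_iff (hn : 1 ≤ n) {r : ℝ} :
    S.IsInradius r ↔ r = Real.arcsin ‖S.inVector‖⁻¹ := by
  have hpos : 0 < ‖S.inVector‖ := norm_pos_iff.mpr S.inVector_ne_zero
  constructor
  · rintro ⟨h0, c, hc, hball, hfacet⟩
    have hlow : ∀ t, 0 ≤ t → t ≤ Real.pi / 2 → t ≤ r → ∀ i,
        ‖S.dual i‖ * Real.sin t ≤ ⟪S.dual i, c⟫ := fun t ht0 ht htr i =>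
      norm_mul_sin_le_inner_of_cap hc ht0 ht fun x hx hcx =>
        (S.mem_region_iff.mp (hball ⟨hx, hcx.trans htr⟩)).2 i
    -- A hemisphere does not fit into the simplex.
    have hr : r < Real.pi / 2 := by
      by_contra! hr
      obtain ⟨i, hi⟩ := S.exists_inner_dual_lt_norm hn hc
      have := hlow _ (by positivity) le_rfl hr i
      rw [Real.sin_pi_div_two, mul_one] at this
      linarith
    have hin : ∀ i, ⟪S.dual i, c⟫ = Real.sin r * ‖S.dual i‖ := by
      intro i
      obtain ⟨x, hx, hcx⟩ := hfacet i
      rw [mul_comm]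
      exact le_antisymm (inner_le_norm_mul_sin_of_touches hc hr.le
        (S.mem_facet_iff.mp hx).2 hcx) (hlow r h0.le hr.le le_rfl i)
    have hcp : c = Real.sin r • S.inVector := by
      rw [← S.sum_inner_dual_smul c, inVector, Finset.smul_sum]
      simp only [hin, mul_smul]
    have hsin : 0 < Real.sin r := Real.sin_pos_of_pos_of_lt_pi h0 (by linarith [Real.pi_pos])
    have hn : Real.sin r * ‖S.inVector‖ = 1 := by
      rw [← hc, hcp, norm_smul, Real.norm_eq_abs, abs_of_pos hsin]
    rw [← eq_inv_of_mul_eq_one_left hn, Real.arcsin_sin (by linarith) hr.le]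
  · intro hr
    have h1 := S.one_lt_norm_inVector hn
    have hinv : ‖S.inVector‖⁻¹ < 1 := inv_lt_one_of_one_lt₀ h1
    have hinv0 : 0 < ‖S.inVector‖⁻¹ := inv_pos.mpr hpos
    have hsin : Real.sin r = ‖S.inVector‖⁻¹ := by
      rw [hr, Real.sin_arcsin (by linarith) hinv.le]
    have hr0 : 0 < r := hr ▸ Real.arcsin_pos.mpr hinv0
    have hr2 : r < Real.pi / 2 := hr ▸ Real.arcsin_lt_pi_div_two.mpr hinv
    have hcos : 0 < Real.cos r := Real.cos_pos_of_mem_Ioo ⟨by linarith, hr2⟩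
    obtain ⟨c, hcdef⟩ : ∃ c, c = ‖S.inVector‖⁻¹ • S.inVector := ⟨_, rfl⟩
    have hc : ‖c‖ = 1 := hcdef ▸ norm_smul_inv_norm S.inVector_ne_zero
    have hin : ∀ i, ⟪S.dual i, c⟫ = ‖S.dual i‖ * Real.sin r := by
      intro i
      rw [hcdef, inner_smul_right, inner_dual_inVector, hsin, mul_comm]
    have hball : sphericalClosedBall c r ⊆ S.region := fun x hx =>
      S.mem_region_iff.mpr ⟨hx.1, fun i =>
        inner_nonneg_of_cap hc hr0.le hr2.le (hin i).ge hx.2⟩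
    refine ⟨hr0, c, hc, hball, fun i => ?_⟩
    have hd : 0 < ‖S.dual i‖ := by
      refine norm_pos_iff.mpr fun h => ?_
      have := S.inner_dual_vertex i i
      simp [h] at this
    have hsc := Real.sin_sq_add_cos_sq r
    -- The normalized orthogonal projection of `c` to the hyperplane of the facet.
    obtain ⟨x, hx⟩ : ∃ x, x = (Real.cos r)⁻¹ • (c - (Real.sin r / ‖S.dual i‖) • S.dual i) :=
      ⟨_, rfl⟩
    have hux : ⟪S.dual i, x⟫ = 0 := by
      rw [hx, inner_smul_right, inner_sub_right, inner_smul_right, hin, real_inner_self_eq_norm_sq]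
      field_simp
      ring
    have hcx : ⟪c, x⟫ = Real.cos r := by
      rw [hx, inner_smul_right, inner_sub_right, inner_smul_right, real_inner_comm (S.dual i),
        hin, real_inner_self_eq_norm_sq, hc]
      field_simp
      linarith
    have hxn : ‖x‖ = 1 := by
      have : ‖x‖ ^ 2 = 1 := by
        rw [← real_inner_self_eq_norm_sq]
        nth_rw 1 [hx]
        rw [real_inner_smul_left, inner_sub_left, real_inner_smul_left, hux, hcx]
        field_simp
        ring
      exact (pow_eq_one_iff_of_nonneg (norm_nonneg x) two_ne_zero).mp this
    have hang : angle c x = r := by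
      rw [angle, hcx, hc, hxn, mul_one, div_one,
        Real.arccos_cos hr0.le (by linarith [Real.pi_pos])]
    exact ⟨x, S.mem_facet_iff.mpr ⟨hball ⟨hxn, hang.le⟩, hux⟩, hang⟩

/-! ### The inequality -/

/-- Euler's inequality in terms of the two centre vectors: with `‖w‖ = 1 / cos R` and
`‖p‖ = 1 / sin r` the two factors are `tan² R` and `1 / tan² r`. -/
theorem sq_le_norm_sq_sub_one_mul :
    (n : ℝ) ^ 2 ≤ (‖S.circumVector‖ ^ 2 - 1) * (‖S.inVector‖ ^ 2 - 1) := by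
  obtain ⟨W, hW⟩ : ∃ W, W = ‖S.circumVector‖ := ⟨_, rfl⟩
  have hW1 : 1 ≤ W := hW ▸ S.one_le_norm_circumVector
  have hWpos : 0 < W := one_pos.trans_le hW1
  obtain ⟨c, hcw⟩ : ∃ c, c = W⁻¹ • S.circumVector := ⟨_, rfl⟩
  have hc : ‖c‖ = 1 := by
    rw [hcw, hW]
    exact norm_smul_inv_norm (norm_pos_iff.mp (hW ▸ hWpos))
  have hvc : ∀ i, ⟪S.vertex i, c⟫ = W⁻¹ := fun i => by
    rw [hcw, inner_smul_right, real_inner_comm, inner_circumVector_vertex, mul_one]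
  obtain ⟨e, he⟩ : ∃ e : Fin (n + 1) → ℝ,
      e = fun i => √(‖S.dual i‖ ^ 2 - ⟪S.dual i, c⟫ ^ 2) := ⟨_, rfl⟩
  obtain ⟨D, hD⟩ : ∃ D, D = ∑ i, ‖S.dual i‖ := ⟨_, rfl⟩
  have hA : ∑ i, ⟪S.dual i, c⟫ = W := by
    rw [← sum_inner, ← circumVector, hcw, inner_smul_right, real_inner_self_eq_norm_sq, ← hW]
    field_simp
  have hac : ∀ i, |⟪S.dual i, c⟫| ≤ ‖S.dual i‖ := fun i => by
    simpa [hc] using abs_real_inner_le_norm (S.dual i) c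
  -- The altitude from a vertex is at most the circumradius plus the distance of the circumcentre
  -- from the opposite facet; summed up with the weights `‖S.dual i‖`.
  have h1 : (n : ℝ) ≤ (∑ i, e i) * √(1 - W⁻¹ ^ 2) := by
    have h : ∀ i, 1 - ⟪S.dual i, c⟫ * W⁻¹ ≤ e i * √(1 - W⁻¹ ^ 2) := fun i => by
      have := inner_sub_mul_inner_le (u := S.dual i) hc (S.norm_vertex i)
      rw [S.inner_dual_vertex, if_pos rfl, hvc] at this
      simpa only [he] using this
    have := Finset.sum_le_sum fun i (_ : i ∈ Finset.univ) => h i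
    rw [Finset.sum_sub_distrib, ← Finset.sum_mul, ← Finset.sum_mul, hA,
      mul_inv_cancel₀ hWpos.ne'] at this
    simpa using this
  have h2 : (∑ i, e i) ^ 2 ≤ D ^ 2 - W ^ 2 := by
    have h := Finset.sum_sq_le_sum_mul_sum_of_sq_le_mul Finset.univ
      (r := e) (f := fun i => ‖S.dual i‖ - ⟪S.dual i, c⟫)
      (g := fun i => ‖S.dual i‖ + ⟪S.dual i, c⟫)
      (fun i _ => by linarith [le_abs_self ⟪S.dual i, c⟫, hac i])
      (fun i _ => by linarith [neg_abs_le ⟪S.dual i, c⟫, hac i])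
      (fun i _ => by
        rw [he, Real.sq_sqrt (sub_nonneg.mpr (sq_le_sq.mpr (by simpa using hac i)))]
        exact le_of_eq (by ring))
    rw [Finset.sum_sub_distrib, Finset.sum_add_distrib, hA, ← hD] at h
    linarith
  have h3 : D ^ 2 ≤ W ^ 2 * ‖S.inVector‖ ^ 2 := by
    have h : ⟪S.inVector, c⟫ = D * W⁻¹ := by
      simp only [inVector, sum_inner, real_inner_smul_left, hvc, hD, Finset.sum_mul]
    have h' := real_inner_le_norm S.inVector c
    rw [h, hc, mul_one, mul_inv_le_iff₀ hWpos, mul_comm] at h'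
    rw [← mul_pow]
    exact pow_le_pow_left₀ (hD ▸ Finset.sum_nonneg fun i _ => norm_nonneg _) h' 2
  have hW2 : W⁻¹ ^ 2 ≤ 1 := pow_le_one₀ (by positivity) (inv_le_one_of_one_le₀ hW1)
  rw [← hW]
  calc (n : ℝ) ^ 2 ≤ ((∑ i, e i) * √(1 - W⁻¹ ^ 2)) ^ 2 :=
        pow_le_pow_left₀ (Nat.cast_nonneg n) h1 2
    _ = (∑ i, e i) ^ 2 * (1 - W⁻¹ ^ 2) := by
        rw [mul_pow, Real.sq_sqrt (sub_nonneg.mpr hW2)]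
    _ ≤ (W ^ 2 * ‖S.inVector‖ ^ 2 - W ^ 2) * (1 - W⁻¹ ^ 2) :=
        mul_le_mul_of_nonneg_right (by linarith) (sub_nonneg.mpr hW2)
    _ = (W ^ 2 - 1) * (‖S.inVector‖ ^ 2 - 1) := by
        field_simp

end SphericalSimplex

theorem theorem4p2 (n : ℕ) (hn : 1 ≤ n) (S : SphericalSimplex n) :
    (∃! R : ℝ, S.IsCircumradius R) ∧ (∃! r : ℝ, S.IsInradius r) ∧
      ∀ R r : ℝ, S.IsCircumradius R → S.IsInradius r → Real.tan R ≥ (n : ℝ) * Real.tan r := by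
  refine ⟨⟨_, S.isCircumradius_iff.mpr rfl, fun _ h => S.isCircumradius_iff.mp h⟩,
    ⟨_, (S.isInradius_iff hn).mpr rfl, fun _ h => (S.isInradius_iff hn).mp h⟩, ?_⟩
  intro R r hR hr
  rw [S.isCircumradius_iff.mp hR, (S.isInradius_iff hn).mp hr, Real.tan_arccos, Real.tan_arcsin]
  have hw := S.one_le_norm_circumVector
  have hp := S.one_lt_norm_inVector hn
  have hsqrt : ∀ a : ℝ, 1 ≤ a → √(1 - a⁻¹ ^ 2) = √(a ^ 2 - 1) / a := fun a ha => by
    have ha0 : 0 < a := one_pos.trans_le ha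
    rw [show 1 - a⁻¹ ^ 2 = (a ^ 2 - 1) / a ^ 2 by field_simp, Real.sqrt_div' _ (sq_nonneg a),
      Real.sqrt_sq ha0.le]
  have hp2 : 0 < √(‖S.inVector‖ ^ 2 - 1) := Real.sqrt_pos.mpr (by nlinarith)
  have hp0 : 0 < ‖S.inVector‖ := by linarith
  have hw0 : 0 < ‖S.circumVector‖ := by linarith
  have htR : √(‖S.circumVector‖ ^ 2 - 1) / ‖S.circumVector‖ / ‖S.circumVector‖⁻¹ =
      √(‖S.circumVector‖ ^ 2 - 1) := by field_simp
  have htr : ‖S.inVector‖⁻¹ / (√(‖S.inVector‖ ^ 2 - 1) / ‖S.inVector‖) =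
      (√(‖S.inVector‖ ^ 2 - 1))⁻¹ := by field_simp
  rw [hsqrt _ hw, hsqrt _ hp.le, htR, htr, ge_iff_le, ← div_eq_mul_inv, div_le_iff₀ hp2,
    ← Real.sqrt_mul (by nlinarith)]
  exact Real.le_sqrt_of_sq_le S.sq_le_norm_sq_sub_one_mul
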